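/- Let $\mathbb K\subset\mathbb R$ be a subfield that is algebraic over $\mathbb Q$, let $n$ be a non-negative integer, and write $X=(X_1,\dots,X_n)$, $U=(U_1,\dots,U_n)$. Let $\mathbb K[X,e^X]$ be the ring of exponential polynomials (E-polynomials), i.e. the $\mathbb K$-algebra of functions $\mathbb R^n\to\mathbb R$ generated by the coordinate functions $X_1,\dots,X_n$ and their exponentials $e^{X_1},\dots,e^{X_n}$. Let $E:\mathbb K[X,U]\to\mathbb K[X,e^X]$ be the map sending a polynomial $P(X,U)$ to the function $P(X,e^X)$. An exponential set is the set of common zeros in $\mathbb R^n$ of finitely many E-polynomials. Then: 1. $E$ is an isomorphism of rings. 2. The ring $\mathbb K[X,e^X]$ is Noetherian. 3. The complements of the exponential sets are exactly the open sets of a topology on $\mathbb R^n$ (the exponential Zariski topology), and this topology is Noetherian. 4. Every exponential set $V\subset\mathbb R^n$ can be written as a finite union $V=V_1\cup\dots\cup V_t$ of exponential sets $V_i$ that are irreducible in this topology, with $V_i\not\subset V_j$ for $i\ne j$; the sets $V_1,\dots,V_t$ (the irreducible components of $V$) are uniquely determined up to order. Here a set is irreducible if it is non-empty and is not the union of two proper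 subsets that are closed in it; the empty exponential set is the empty union ($t=0$). -/

import Mathlib

namespace ExpPoly

/-- The functions `X₁, …, Xₙ` and `e^{X₁}, …, e^{Xₙ}` on `ℝⁿ`. The index `Sum.inl i` stands for
the variable `Xᵢ` and the index `Sum.inr i` for the variable `Uᵢ`. -/
noncomputable def gen (n : ℕ) : Fin n ⊕ Fin n → ((Fin n → ℝ) → ℝ) :=
  Sum.elim (fun i x => x i) (fun i x => Real.exp (x i))

/-- The ring `K[X, e^X]` of exponential polynomials (`E`-polynomials) over `K`: the `K`-algebra of
functions `ℝⁿ → ℝ` generated by the coordinate functions and their exponentials. -/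
noncomputable def ePolynomials (K : IntermediateField ℚ ℝ) (n : ℕ) :
    Subalgebra K ((Fin n → ℝ) → ℝ) :=
  Algebra.adjoin K (Set.range (gen n))

theorem aeval_gen_mem (K : IntermediateField ℚ ℝ) (n : ℕ)
    (P : MvPolynomial (Fin n ⊕ Fin n) K) :
    MvPolynomial.aeval (gen n) P ∈ ePolynomials K n := by
  rw [ePolynomials, Algebra.adjoin_range_eq_range_aeval]
  exact ⟨P, rfl⟩

/-- The map `E : K[X, U] → K[X, e^X]`, `P(X, U) ↦ P(X, e^X)`, as a homomorphism of rings (and of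
`K`-algebras). -/
noncomputable def evalE (K : IntermediateField ℚ ℝ) (n : ℕ) :
    MvPolynomial (Fin n ⊕ Fin n) K →ₐ[K] ePolynomials K n :=
  (MvPolynomial.aeval (gen n)).codRestrict (ePolynomials K n) (aeval_gen_mem K n)

/-- The value of the function `E(P)` at `x` is `P(x, e^x)`. -/
theorem evalE_apply (K : IntermediateField ℚ ℝ) (n : ℕ)
    (P : MvPolynomial (Fin n ⊕ Fin n) K) (x : Fin n → ℝ) :
    (evalE K n P : (Fin n → ℝ) → ℝ) x
      = MvPolynomial.aeval (Sum.elim x (fun i => Real.exp (x i))) P := by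
  have h : (Pi.evalAlgHom K (fun _ : Fin n → ℝ => ℝ) x).comp (MvPolynomial.aeval (gen n))
      = MvPolynomial.aeval (Sum.elim x (fun i => Real.exp (x i))) := by
    apply MvPolynomial.algHom_ext
    rintro (i | i) <;> simp [gen]
  exact DFunLike.congr_fun h P

/-- The common zero set in `ℝⁿ` of a set of exponential polynomials. -/
def zeros {K : IntermediateField ℚ ℝ} {n : ℕ} (F : Set (ePolynomials K n)) :
    Set (Fin n → ℝ) :=
  {x | ∀ f ∈ F, (f : (Fin n → ℝ) → ℝ) x = 0}

/-- Exponential sets over `K`: zero sets of finitely many exponential polynomials over `K`. -/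
def IsExponentialSet (K : IntermediateField ℚ ℝ) {n : ℕ} (V : Set (Fin n → ℝ)) : Prop :=
  ∃ F : Set (ePolynomials K n), F.Finite ∧ V = zeros F

/-- The exponential Zariski topology on `ℝⁿ`, generated by the complements of exponential sets. -/
@[reducible]
def zariskiTopology (K : IntermediateField ℚ ℝ) (n : ℕ) : TopologicalSpace (Fin n → ℝ) :=
  TopologicalSpace.generateFrom {U | IsExponentialSet K Uᶜ}

/-- `V` is an irreducible exponential set: it is an exponential set, it is non-empty, and it is
irreducible in the exponential Zariski topology. -/
def IsIrreducibleExponentialSet (K : IntermediateField ℚ ℝ) {n : ℕ} (V : Set (Fin n → ℝ)) :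
    Prop :=
  IsExponentialSet K V ∧ @IsIrreducible (Fin n → ℝ) (zariskiTopology K n) V

end ExpPoly

open Filter Topology

namespace ExpPoly

/-! Only the injectivity of `E` needs analysis: it says that no nonzero polynomial vanishes on the
graph of the exponential map. The constraints `uᵢ = exp xᵢ` are released one coordinate at a time,
each by the growth argument in one variable (`eq_zero_of_evalEval_exp_neg`). The rest is formal. The
ring is a quotient of a polynomial ring, hence Noetherian; so any family of equations reduces to a
finite one, chains of open sets correspond to chains of ideals, and components exist as in any
Noetherian space. -/

theorem tendsto_exp_neg_mul_eval (p : Polynomial (Polynomial ℝ)) :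
    Tendsto (fun t : ℝ => Real.exp (-t) * p.evalEval t (Real.exp (-t))) atTop (𝓝 0) := by
  induction p using Polynomial.induction_on' with
  | add p q hp hq => simpa [Polynomial.evalEval_add, mul_add] using hp.add hq
  | monomial m a =>
    induction a using Polynomial.induction_on' with
    | add a b ha hb =>
      simpa [Polynomial.evalEval_add, mul_add, map_add] using ha.add hb
    | monomial k c =>
      have h1 := Real.tendsto_pow_mul_exp_neg_atTop_nhds_zero k
      have h2 : IsBoundedUnder (· ≤ ·) atTop
          ((‖·‖) ∘ fun t : ℝ => c * Real.exp (-t) ^ m) := by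
        refine isBoundedUnder_of_eventually_le (a := |c|) ?_
        filter_upwards [eventually_ge_atTop (0 : ℝ)] with t ht
        have h : Real.exp (-t) ^ m ≤ 1 :=
          pow_le_one₀ (Real.exp_pos _).le (Real.exp_le_one_iff.2 (by linarith))
        simpa [abs_mul] using mul_le_mul_of_nonneg_left h (abs_nonneg c)
      refine (h1.zero_mul_isBoundedUnder_le h2).congr fun t => ?_
      simp only [Polynomial.evalEval, Polynomial.eval_monomial, Polynomial.eval_mul,
        Polynomial.eval_pow, Polynomial.eval_C]
      ring

/-- A real polynomial in `t` and `e^{-t}` that vanishes identically is zero. -/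
theorem eq_zero_of_evalEval_exp_neg (p : Polynomial (Polynomial ℝ))
    (hp : ∀ t : ℝ, p.evalEval t (Real.exp (-t)) = 0) : p = 0 := by
  induction hd : p.natDegree using Nat.strong_induction_on generalizing p with
  | _ d ih =>
    have hsplit (t : ℝ) : p.evalEval t (Real.exp (-t)) =
        Real.exp (-t) * p.divX.evalEval t (Real.exp (-t)) + (p.coeff 0).eval t := by
      conv_lhs => rw [← p.divX_mul_X_add]
      rw [Polynomial.evalEval_add, Polynomial.evalEval_mul, Polynomial.evalEval_X,
        Polynomial.evalEval_C, mul_comm]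
    -- As `t → ∞` the terms divisible by `e^{-t}` vanish, so this polynomial in `t` tends to `0`,
    -- which forces it to be zero.
    have h0 : p.coeff 0 = 0 := by
      have h : Tendsto (fun t => (p.coeff 0).eval t) atTop (𝓝 0) := by
        have := (tendsto_exp_neg_mul_eval p.divX).neg
        rw [neg_zero] at this
        refine this.congr fun t => ?_
        linarith [hsplit t, hp t]
      have h' := (Polynomial.tendsto_nhds_iff _).1 h
      exact Polynomial.leadingCoeff_eq_zero.1 h'.1
    have hdiv (t : ℝ) : p.divX.evalEval t (Real.exp (-t)) = 0 := by
      have := hsplit t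
      rw [hp t, h0] at this
      simpa [Real.exp_ne_zero] using this.symm
    rw [← p.divX_mul_X_add, h0]
    rcases Nat.eq_zero_or_pos p.natDegree with h | h
    · rw [Polynomial.divX_eq_zero_iff.2 (Polynomial.eq_C_of_natDegree_eq_zero h)]
      simp
    · rw [ih _ (by rw [Polynomial.natDegree_divX_eq_natDegree_tsub_one]; omega) p.divX hdiv rfl]
      simp

/-- A real polynomial that vanishes on the graph of the exponential map is zero. -/
theorem eq_zero_of_eval_exp {n : ℕ} (P : MvPolynomial (Fin n ⊕ Fin n) ℝ)
    (hP : ∀ x : Fin n → ℝ, MvPolynomial.eval (Sum.elim x fun i => Real.exp (x i)) P = 0) :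
    P = 0 := by
  -- `S` is the set of coordinates in which `u` is already free of `x`.
  have key (S : Finset (Fin n)) : ∀ x u : Fin n → ℝ, (∀ i ∉ S, u i = Real.exp (x i)) →
      MvPolynomial.eval (Sum.elim x u) P = 0 := by
    induction S using Finset.induction_on with
    | empty =>
      intro x u h
      rw [← hP x]
      congr 2
      exact congrArg (Sum.elim x) (funext fun i => h i (by simp))
    | insert j S hj ih =>
      intro x u h
      -- Freeze all variables except the `j`-th pair; the sign turns `e^{Xⱼ}` into the decaying
      -- `e^{-t}`.
      let φ : MvPolynomial (Fin n ⊕ Fin n) ℝ →+* Polynomial (Polynomial ℝ) :=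
        MvPolynomial.eval₂Hom (Polynomial.C.comp Polynomial.C) (Sum.elim
          (fun i => if i = j then Polynomial.C (-Polynomial.X)
            else Polynomial.C (Polynomial.C (x i)))
          (fun i => if i = j then Polynomial.X else Polynomial.C (Polynomial.C (u i))))
      have hp (s v : ℝ) : (φ P).evalEval s v = MvPolynomial.eval
          (Sum.elim (Function.update x j (-s)) (Function.update u j v)) P := by
        have hcomp : (Polynomial.evalEvalRingHom s v).comp φ = MvPolynomial.eval
            (Sum.elim (Function.update x j (-s)) (Function.update u j v)) := by
          apply MvPolynomial.ringHom_ext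
          · intro r
            rw [RingHom.comp_apply, MvPolynomial.eval₂Hom_C, Polynomial.coe_evalEvalRingHom,
              MvPolynomial.eval_C, RingHom.comp_apply, Polynomial.evalEval_C, Polynomial.eval_C]
          · rintro (i | i) <;>
              rw [RingHom.comp_apply, MvPolynomial.eval₂Hom_X', Polynomial.coe_evalEvalRingHom,
                MvPolynomial.eval_X] <;>
              by_cases hi : i = j <;>
              simp [Polynomial.evalEval_C, Polynomial.evalEval_X, hi]
        exact DFunLike.congr_fun hcomp P
      have hp0 : φ P = 0 := by
        apply eq_zero_of_evalEval_exp_neg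
        intro t
        rw [hp]
        apply ih
        intro i hi
        by_cases hij : i = j
        · subst hij; simp
        · simpa [hij] using h i (by simp [hij, hi])
      have := hp (-x j) (u j)
      simpa [hp0] using this.symm
  apply MvPolynomial.funext
  intro y
  have := key Finset.univ (y ∘ Sum.inl) (y ∘ Sum.inr) (by simp)
  simpa using this

variable {K : IntermediateField ℚ ℝ} {n : ℕ}

theorem evalE_injective (K : IntermediateField ℚ ℝ) (n : ℕ) :
    Function.Injective (evalE K n) := by
  rw [injective_iff_map_eq_zero]
  intro P hP
  apply MvPolynomial.map_injective (algebraMap K ℝ) (algebraMap K ℝ).injective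
  rw [map_zero]
  apply eq_zero_of_eval_exp
  intro x
  rw [MvPolynomial.eval_map, ← MvPolynomial.aeval_def, ← evalE_apply, hP]
  rfl

theorem evalE_surjective (K : IntermediateField ℚ ℝ) (n : ℕ) :
    Function.Surjective (evalE K n) := by
  rintro ⟨f, hf⟩
  rw [ePolynomials, Algebra.adjoin_range_eq_range_aeval] at hf
  obtain ⟨P, hP⟩ := hf
  exact ⟨P, Subtype.ext hP⟩

instance isNoetherianRing_ePolynomials (K : IntermediateField ℚ ℝ) (n : ℕ) :
    IsNoetherianRing (ePolynomials K n) :=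
  isNoetherianRing_of_surjective _ _ (evalE K n).toRingHom (evalE_surjective K n)

theorem zeros_span (F : Set (ePolynomials K n)) :
    zeros (Ideal.span F : Set (ePolynomials K n)) = zeros F := by
  refine Set.Subset.antisymm (fun x hx f hf => hx f (Ideal.subset_span hf)) fun x hx f hf => ?_
  induction hf using Submodule.span_induction with
  | mem f hf => exact hx f hf
  | zero => rfl
  | add f g _ _ hf hg => simp [hf, hg]
  | smul a f _ hf => simp [hf]

/-- The ideal spanned by `F` has finitely many generators, with the same zeros. -/
theorem isExponentialSet_zeros (F : Set (ePolynomials K n)) : IsExponentialSet K (zeros F) := by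
  obtain ⟨G, hG⟩ := (isNoetherianRing_iff_ideal_fg _).1
    (isNoetherianRing_ePolynomials K n) (Ideal.span F)
  refine ⟨G, G.finite_toSet, ?_⟩
  rw [← zeros_span F, ← zeros_span (G : Set (ePolynomials K n)), ← hG]

theorem isExponentialSet_empty : IsExponentialSet K (∅ : Set (Fin n → ℝ)) :=
  ⟨{1}, Set.finite_singleton _, by ext x; simp [zeros]⟩

theorem IsExponentialSet.union {V W : Set (Fin n → ℝ)} (hV : IsExponentialSet K V)
    (hW : IsExponentialSet K W) : IsExponentialSet K (V ∪ W) := by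
  obtain ⟨F, -, rfl⟩ := hV
  obtain ⟨G, -, rfl⟩ := hW
  convert isExponentialSet_zeros (Set.image2 (· * ·) F G) using 1
  ext x
  constructor
  · rintro (h | h) _ ⟨f, hf, g, hg, rfl⟩
    · simp [h f hf]
    · simp [h g hg]
  · intro h
    by_contra! hx
    simp only [Set.mem_union, zeros, Set.mem_ofPred_eq, not_or, not_forall] at hx
    obtain ⟨⟨f, hf, hfx⟩, g, hg, hgx⟩ := hx
    have := h _ ⟨f, hf, g, hg, rfl⟩
    simp [hfx, hgx] at this

theorem isExponentialSet_sInter {S : Set (Set (Fin n → ℝ))}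
    (hS : ∀ V ∈ S, IsExponentialSet K V) : IsExponentialSet K (⋂₀ S) := by
  convert isExponentialSet_zeros {f : ePolynomials K n | ∃ V ∈ S, ∀ x ∈ V,
    (f : (Fin n → ℝ) → ℝ) x = 0} using 1
  ext x
  constructor
  · rintro h f ⟨V, hV, hf⟩
    exact hf x (h V hV)
  · intro h V hV
    obtain ⟨F, -, rfl⟩ := hS V hV
    exact fun f hf => h f ⟨_, hV, fun y hy => hy f hf⟩

theorem isOpen_zariskiTopology_iff (U : Set (Fin n → ℝ)) :
    IsOpen[zariskiTopology K n] U ↔ IsExponentialSet K Uᶜ := by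
  refine ⟨fun h => ?_, fun h => TopologicalSpace.isOpen_generateFrom_of_mem h⟩
  induction h with
  | basic s hs => exact hs
  | univ => simpa using isExponentialSet_empty
  | inter s t _ _ hs ht => rw [Set.compl_inter]; exact hs.union ht
  | sUnion S _ ih =>
    rw [Set.compl_sUnion]
    exact isExponentialSet_sInter (by rintro _ ⟨V, hV, rfl⟩; exact ih V hV)

theorem isClosed_zariskiTopology_iff (V : Set (Fin n → ℝ)) :
    IsClosed[zariskiTopology K n] V ↔ IsExponentialSet K V := by
  rw [← @isOpen_compl_iff _ _ (zariskiTopology K n), isOpen_zariskiTopology_iff, compl_compl]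

theorem noetherianSpace_zariskiTopology (K : IntermediateField ℚ ℝ) (n : ℕ) :
    @TopologicalSpace.NoetherianSpace (Fin n → ℝ) (zariskiTopology K n) := by
  let := zariskiTopology K n
  -- The functions vanishing off `U`. They recover `U`, so the ascending chain condition passes from
  -- ideals to open sets.
  let I (U : TopologicalSpace.Opens (Fin n → ℝ)) : Ideal (ePolynomials K n) :=
    { carrier := {f | ∀ x ∉ U, (f : (Fin n → ℝ) → ℝ) x = 0}
      add_mem' := fun hf hg x hx => by simp [hf x hx, hg x hx]
      zero_mem' := fun _ _ => rfl
      smul_mem' := fun a f hf x hx => by simp [hf x hx] }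
  have hle {U V : TopologicalSpace.Opens (Fin n → ℝ)} (h : I U ≤ I V) : U ≤ V := by
    intro x hxU
    by_contra hxV
    obtain ⟨F, -, hF⟩ := (isOpen_zariskiTopology_iff (K := K) (U : Set (Fin n → ℝ))).1 U.isOpen
    have : x ∈ (U : Set (Fin n → ℝ))ᶜ := by
      rw [hF]
      exact fun f hf => h (fun y hy => (hF.subset hy) f hf : f ∈ I U) x hxV
    exact this hxU
  have hmono : StrictMono I := by
    intro U V h
    exact lt_of_le_not_ge (fun f hf x hx => hf x fun hU => hx (h.le hU))
      fun h' => h.not_ge (hle h')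
  exact (hmono.wellFoundedGT : WellFoundedGT (TopologicalSpace.Opens (Fin n → ℝ)))

/-- In a Noetherian space a closed set is, in a unique way, a finite union of irreducible closed
sets none of which contains another. -/
theorem existsUnique_irreducible_decomposition {α : Type*} [TopologicalSpace α]
    [TopologicalSpace.NoetherianSpace α] {V : Set α} (hV : IsClosed V) :
    ∃! S : Set (Set α), S.Finite ∧ (∀ W ∈ S, IsClosed W ∧ IsIrreducible W) ∧
      IsAntichain (fun A B : Set α => A ⊆ B) S ∧ V = ⋃₀ S := by
  have exists_superset {S : Set (Set α)} (hS : S.Finite)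
      (hc : ∀ W ∈ S, IsClosed W ∧ IsIrreducible W) {Z : Set α} (hZ : IsIrreducible Z) (h : Z ⊆ ⋃₀ S) : ∃ W ∈ S, Z ⊆ W := by
    have := isIrreducible_iff_sUnion_isClosed.1 hZ hS.toFinset
      (fun W hW => (hc W (hS.mem_toFinset.1 hW)).1) (by simpa using h)
    simpa using this
  have subset_of {S T : Set (Set α)} (hS : S.Finite) (hT : T.Finite)
      (hSc : ∀ W ∈ S, IsClosed W ∧ IsIrreducible W) (hTc : ∀ W ∈ T, IsClosed W ∧ IsIrreducible W)
      (hSa : IsAntichain (fun A B : Set α => A ⊆ B) S) (h : ⋃₀ S = ⋃₀ T) : S ⊆ T := by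
    intro W hW
    obtain ⟨Z, hZ, hWZ⟩ := exists_superset hT hTc (hSc W hW).2
      ((Set.subset_sUnion_of_mem hW).trans h.subset)
    obtain ⟨W', hW', hZW'⟩ := exists_superset hS hSc (hTc Z hZ).2
      ((Set.subset_sUnion_of_mem hZ).trans h.symm.subset)
    -- `W ⊆ Z ⊆ W'` with both ends in the antichain `S`, so all three agree.
    have hWW' : W = W' := hSa.eq hW hW' (hWZ.trans hZW')
    rwa [hWZ.antisymm (hWW' ▸ hZW')]
  obtain ⟨T, hT, hTc, hTi, hVT⟩ :=
    TopologicalSpace.NoetherianSpace.exists_finite_set_isClosed_irreducible hV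
  -- Discarding non-maximal members makes `T` an antichain without changing its union.
  refine existsUnique_of_exists_of_unique ⟨{W | Maximal (· ∈ T) W},
    hT.subset fun W hW => hW.1, fun W hW => ⟨hTc W hW.1, hTi W hW.1⟩,
    fun A hA B hB hAB h => hAB (hA.eq_of_le hB.1 h), ?_⟩ ?_
  · rw [hVT]
    refine Set.Subset.antisymm ?_ (Set.sUnion_subset_sUnion fun W hW => hW.1)
    rintro x ⟨W, hW, hxW⟩
    obtain ⟨Z, hWZ, hZ⟩ := hT.exists_le_maximal hW
    exact ⟨Z, hZ, hWZ hxW⟩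
  · rintro S S' ⟨hS, hSc, hSa, hVS⟩ ⟨hS', hSc', hSa', hVS'⟩
    exact (subset_of hS hS' hSc hSc' hSa (hVS.symm.trans hVS')).antisymm
      (subset_of hS' hS hSc' hSc hSa' (hVS'.symm.trans hVS))

end ExpPoly

theorem mainTheorem9 (K : IntermediateField ℚ ℝ) [Algebra.IsAlgebraic ℚ K] (n : ℕ) :
    -- the ring homomorphism `E` is an isomorphism
    Function.Bijective (ExpPoly.evalE K n) ∧
    -- the ring of exponential polynomials is Noetherian
    IsNoetherianRing (ExpPoly.ePolynomials K n) ∧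
    -- the complements of the exponential sets are exactly the open sets of a topology
    (∀ U : Set (Fin n → ℝ),
      @IsOpen (Fin n → ℝ) (ExpPoly.zariskiTopology K n) U ↔ ExpPoly.IsExponentialSet K Uᶜ) ∧
    -- this topology is Noetherian
    @TopologicalSpace.NoetherianSpace (Fin n → ℝ) (ExpPoly.zariskiTopology K n) ∧
    -- unique decomposition into irreducible exponential sets, none contained in another
    (∀ V : Set (Fin n → ℝ), ExpPoly.IsExponentialSet K V →
      ∃! S : Set (Set (Fin n → ℝ)),
        S.Finite ∧ (∀ W ∈ S, ExpPoly.IsIrreducibleExponentialSet K W) ∧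
        IsAntichain (fun A B : Set (Fin n → ℝ) => A ⊆ B) S ∧ V = ⋃₀ S) := by
  refine ⟨⟨ExpPoly.evalE_injective K n, ExpPoly.evalE_surjective K n⟩,
    ExpPoly.isNoetherianRing_ePolynomials K n, ExpPoly.isOpen_zariskiTopology_iff,
    ExpPoly.noetherianSpace_zariskiTopology K n, fun V hV => ?_⟩
  let := ExpPoly.zariskiTopology K n
  have := ExpPoly.noetherianSpace_zariskiTopology K n
  simpa only [ExpPoly.IsIrreducibleExponentialSet, ExpPoly.isClosed_zariskiTopology_iff] using
    ExpPoly.existsUnique_irreducible_decomposition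
      ((ExpPoly.isClosed_zariskiTopology_iff V).2 hV)
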